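/- Let $H$ be a real separable Hilbert space, $(W(h))_{h\in H}$ an isonormal process on a probability space $(\Omega,\mathcal F,P)$, i.e. a centered Gaussian family with $E[W(g)W(h)]=\langle g,h\rangle$, and $(e_i)_{i}$ a (countable) complete orthonormal system of $H$. For $n\ge 0$ let $I_n$ be the multiple Wiener–Itô integral: on symmetric tensors it is the linear continuous extension to $L^2(\Omega)$ of $h^{\otimes n}\mapsto H_n(W(h))$, $\|h\|=1$, with $H_n$ the monic Hermite polynomial of degree $n$, and $I_n(f)=I_n(\tilde f)$ for general $f\in H^{\otimes n}$ with symmetrization $\tilde f$. Let $D$ be the Malliavin derivative with respect to $W$, i.e. the closed operator from $L^2(\Omega)$ to $L^2(\Omega;H)$ obtained by closing $\varphi(W(h_1),\dots,W(h_k))\mapsto\sum_i\partial_i\varphi(W(h_1),\dots,W(h_k))h_i$ for $\varphi\in C^\infty(\mathbb R^k)$ with polynomial growth of all derivatives. Let $n,m\ge 1$, let $f\in H^{\otimes n}$ and $g\in H^{\otimes m}$ be symmetric, with coefficients $\lambda_{j_1,\dots,j_n}=\langle f,e_{j_1}\otimes\cdots\otimes e_{j_n}\rangle$ and $\beta_{k_1,\dots,k_m}=\langle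 g,e_{k_1}\otimes\cdots\otimes e_{k_m}\rangle$, and put $F=I_n(f)$, $G=I_m(g)$. For every $i$ the series $$S_{i,f}=n\sum_{j_2,\dots,j_n}\lambda_{i,j_2,\dots,j_n}\,I_{n-1}(e_{j_2}\otimes\cdots\otimes e_{j_n}),\qquad S_{i,g}=m\sum_{k_2,\dots,k_m}\beta_{i,k_2,\dots,k_m}\,I_{m-1}(e_{k_2}\otimes\cdots\otimes e_{k_m})$$ converge unconditionally in $L^2(\Omega)$, $F$ and $G$ belong to the domain of $D$, and almost surely $S_{i,f}=\langle DF,e_i\rangle$ and $S_{i,g}=\langle DG,e_i\rangle$ for every $i$. Moreover, the determinant of the Malliavin matrix $$\Lambda=\begin{pmatrix}\|DF\|_H^2&\langle DF,DG\rangle_H\\ \langle DF,DG\rangle_H&\|DG\|_H^2\end{pmatrix}$$ satisfies, almost surely, $$\det\Lambda=\frac12\sum_{i,l}\bigl(S_{i,f}S_{l,g}-S_{l,f}S_{i,g}\bigr)^2,$$ where the series converges. -/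

import Mathlib

open MeasureTheory ProbabilityTheory TopologicalSpace
open scoped TensorProduct

noncomputable section

namespace MalliavinDet

/-! ### The Hilbert tensor powers of a real Hilbert space -/

section TensorPower

variable (n : ℕ) (H : Type*) [NormedAddCommGroup H] [InnerProductSpace ℝ H]

/-- The algebraic tensor power of order `n`, to be equipped with the scalar product determined by
`⟪x₁ ⊗ ⋯ ⊗ xₙ, y₁ ⊗ ⋯ ⊗ yₙ⟫ = ∏ₖ ⟪xₖ, yₖ⟫`. -/
def AlgTensorPower : Type _ := ⨂[ℝ] _ : Fin n, H

instance : AddCommGroup (AlgTensorPower n H) :=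
  inferInstanceAs (AddCommGroup (⨂[ℝ] _ : Fin n, H))

instance : Module ℝ (AlgTensorPower n H) :=
  inferInstanceAs (Module ℝ (⨂[ℝ] _ : Fin n, H))

/-- The canonical multilinear map `(x₁, …, xₙ) ↦ x₁ ⊗ ⋯ ⊗ xₙ`. -/
def algTprod : MultilinearMap ℝ (fun _ : Fin n => H) (AlgTensorPower n H) :=
  PiTensorProduct.tprod ℝ

/-- The bilinear form on the algebraic tensor power with
`(x₁ ⊗ ⋯ ⊗ xₙ, y₁ ⊗ ⋯ ⊗ yₙ) ↦ ∏ₖ ⟪xₖ, yₖ⟫`. -/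
def algForm : (⨂[ℝ] _ : Fin n, H) →ₗ[ℝ] Module.Dual ℝ (⨂[ℝ] _ : Fin n, H) :=
  PiTensorProduct.dualDistrib ∘ₗ PiTensorProduct.map (fun _ => innerₗ H)

theorem algForm_tprod (x y : Fin n → H) :
    algForm n H (PiTensorProduct.tprod ℝ x) (PiTensorProduct.tprod ℝ y)
      = ∏ k, inner ℝ (x k) (y k) := by
  simp [algForm, PiTensorProduct.map_tprod]

theorem exists_eq_sum (t : ⨂[ℝ] _ : Fin n, H) :
    ∃ (N : ℕ) (c : Fin N → ℝ) (x : Fin N → Fin n → H),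
      t = ∑ a, c a • PiTensorProduct.tprod ℝ (x a) := by
  have ht : t ∈ Submodule.span ℝ
      (Set.range (PiTensorProduct.tprod ℝ : MultilinearMap ℝ (fun _ : Fin n => H) _)) := by
    rw [PiTensorProduct.span_tprod_eq_top]
    trivial
  obtain ⟨N, c, g, h⟩ := Submodule.mem_span_set'.1 ht
  choose x hx using fun a => (g a).2
  refine ⟨N, c, x, ?_⟩
  rw [← h]
  simp [hx]

theorem algForm_symm (s t : ⨂[ℝ] _ : Fin n, H) : algForm n H s t = algForm n H t s := by
  obtain ⟨N, c, x, rfl⟩ := exists_eq_sum n H s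
  obtain ⟨M, d, y, rfl⟩ := exists_eq_sum n H t
  simp only [map_sum, map_smul, LinearMap.sum_apply, LinearMap.smul_apply, algForm_tprod,
    smul_eq_mul, Finset.mul_sum]
  rw [Finset.sum_comm]
  refine Finset.sum_congr rfl fun a _ => Finset.sum_congr rfl fun b _ => ?_
  rw [Finset.prod_congr rfl fun k _ => real_inner_comm (y b k) (x a k)]
  ring

theorem posSemidef_prod {N : ℕ} (x : Fin N → Fin n → H) (s : Finset (Fin n)) :
    (Matrix.of fun a b => ∏ k ∈ s, inner ℝ (x a k) (x b k) :
      Matrix (Fin N) (Fin N) ℝ).PosSemidef := by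
  classical
  induction s using Finset.induction_on with
  | empty =>
    have := Matrix.posSemidef_vecMulVec_self_star (fun _ : Fin N => (1 : ℝ))
    have h : (Matrix.of fun a b => ∏ k ∈ (∅ : Finset (Fin n)), inner ℝ (x a k) (x b k) :
        Matrix (Fin N) (Fin N) ℝ) = Matrix.vecMulVec (fun _ => 1) (star fun _ => 1) := by
      ext a b
      simp [Matrix.vecMulVec]
    rw [h]
    exact this
  | insert k s hk ih =>
    have h1 : (Matrix.gram ℝ (fun a => x a k)).PosSemidef := Matrix.posSemidef_gram ℝ _
    have h : (Matrix.of fun a b => ∏ k ∈ insert k s, inner ℝ (x a k) (x b k) :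
        Matrix (Fin N) (Fin N) ℝ) = (Matrix.gram ℝ (fun a => x a k)).hadamard
          (Matrix.of fun a b => ∏ k ∈ s, inner ℝ (x a k) (x b k)) := by
      ext a b
      simp [Finset.prod_insert hk, Matrix.gram]
    rw [h]
    exact h1.hadamard ih

theorem algForm_self_nonneg (t : ⨂[ℝ] _ : Fin n, H) : 0 ≤ algForm n H t t := by
  obtain ⟨N, c, x, rfl⟩ := exists_eq_sum n H t
  have h := (posSemidef_prod n H x Finset.univ).dotProduct_mulVec_nonneg c
  simp only [dotProduct, Matrix.mulVec, Matrix.of_apply, Pi.star_apply, star_trivial,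
    Finset.mul_sum] at h
  simp only [map_sum, map_smul, LinearMap.sum_apply, LinearMap.smul_apply, algForm_tprod,
    smul_eq_mul, Finset.mul_sum]
  rw [Finset.sum_comm]
  refine h.trans_eq ?_
  refine Finset.sum_congr rfl fun a _ => Finset.sum_congr rfl fun b _ => ?_
  ring

/-- The positive semidefinite scalar product of the algebraic tensor power. -/
@[reducible]
def algCore : PreInnerProductSpace.Core ℝ (AlgTensorPower n H) where
  inner s t := algForm n H s t
  conj_inner_symm s t := algForm_symm n H t s
  re_inner_nonneg t := algForm_self_nonneg n H t
  add_left s t u := by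
    have := LinearMap.congr_fun ((algForm n H).map_add s t) u
    exact this
  smul_left s t r := by
    have := LinearMap.congr_fun ((algForm n H).map_smul r s) t
    exact this

instance : SeminormedAddCommGroup (AlgTensorPower n H) :=
  @InnerProductSpace.Core.toSeminormedAddCommGroup ℝ (AlgTensorPower n H) _ _ _ (algCore n H)

instance : InnerProductSpace ℝ (AlgTensorPower n H) :=
  InnerProductSpace.ofCore (algCore n H)

/-- The Hilbert tensor power `H^{⊗n}`: the Hausdorff completion of the algebraic tensor power. -/
abbrev HilbertTensorPower : Type _ := UniformSpace.Completion (AlgTensorPower n H)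

variable {n H}

/-- The elementary tensor `x₁ ⊗ ⋯ ⊗ xₙ` in `H^{⊗n}`. -/
def elemTensor (x : Fin n → H) : HilbertTensorPower n H :=
  (algTprod n H x : UniformSpace.Completion (AlgTensorPower n H))

theorem inner_elemTensor (x y : Fin n → H) :
    inner ℝ (elemTensor x) (elemTensor y) = ∏ k, inner ℝ (x k) (y k) := by
  rw [elemTensor, elemTensor, UniformSpace.Completion.inner_coe]
  exact algForm_tprod n H x y

variable (n H)

/-- The closed subspace of symmetric tensors: those whose coefficients against elementary tensors
do not change when the factors are permuted. -/
def symTensors : Submodule ℝ (HilbertTensorPower n H) where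
  carrier := {f | ∀ (σ : Equiv.Perm (Fin n)) (x : Fin n → H),
    inner ℝ f (elemTensor (x ∘ σ)) = inner ℝ f (elemTensor x)}
  add_mem' hf hg σ x := by rw [inner_add_left, inner_add_left, hf σ x, hg σ x]
  zero_mem' σ x := by simp
  smul_mem' c f hf σ x := by rw [inner_smul_left, inner_smul_left, hf σ x]

theorem isClosed_symTensors :
    IsClosed (symTensors n H : Set (HilbertTensorPower n H)) := by
  have : (symTensors n H : Set (HilbertTensorPower n H)) =
      ⋂ (σ : Equiv.Perm (Fin n)) (x : Fin n → H),
        {f | inner ℝ f (elemTensor (x ∘ σ)) = inner ℝ f (elemTensor x)} := by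
    ext f
    simp [symTensors]
  rw [this]
  exact isClosed_iInter fun σ => isClosed_iInter fun x =>
    isClosed_eq (by fun_prop) (by fun_prop)

instance : CompleteSpace (symTensors n H) :=
  (isClosed_symTensors n H).completeSpace_coe

/-- Symmetrization `f ↦ f̃`, which is the orthogonal projection onto the symmetric tensors. -/
def symmetrize : HilbertTensorPower n H →L[ℝ] HilbertTensorPower n H :=
  (symTensors n H).starProjection

end TensorPower

/-! ### Isonormal processes, multiple integrals and the Malliavin derivative -/

section Wiener

variable {H : Type*} [NormedAddCommGroup H] [InnerProductSpace ℝ H]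
  {Ω : Type*} [MeasurableSpace Ω]

/-- `W` is an isonormal process over `H`: a centered Gaussian family indexed by `H` with
covariance `E[W(g) W(h)] = ⟪g, h⟫`. -/
structure IsIsonormal (W : H → Ω → ℝ) (P : Measure Ω) : Prop where
  isGaussianProcess : IsGaussianProcess W P
  centered : ∀ h, ∫ ω, W h ω ∂P = 0
  covariance : ∀ g h, ∫ ω, W g ω * W h ω ∂P = inner ℝ g h

/-- The multiple integral of order `n` on symmetric tensors: the map
`h^{⊗n} ↦ Hₙ(W(h))`, `‖h‖ = 1`, extended by linearity and continuity (that is, by closing the linear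
span of its graph in `H^{⊗n} × L²(Ω)`). Here `Hₙ` is the monic Hermite polynomial, for which this map
is an isometry for the norm `√(n!) ‖·‖`. For `n = 0` the vector `h` plays no role, and the map sends
the unit `1` of `H^{⊗0}` to the constant `1`, also when `H` has no unit vector. -/
def wienerItoMap (W : H → Ω → ℝ) (P : Measure Ω) (n : ℕ) :
    HilbertTensorPower n H →ₗ.[ℝ] Lp ℝ 2 P :=
  (Submodule.span ℝ {p : HilbertTensorPower n H × Lp ℝ 2 P |
    ∃ h : H, (‖h‖ = 1 ∨ n = 0) ∧ p.1 = elemTensor (fun _ => h) ∧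
      p.2 =ᵐ[P] fun ω => Polynomial.aeval (W h ω) (Polynomial.hermite n)}
    ).topologicalClosure.toLinearPMap

open Classical in
/-- The multiple Wiener–Itô integral `Iₙ(f) = Iₙ(f̃)` of `f ∈ H^{⊗n}`. For an isonormal process
the domain of `wienerItoMap` is the space of all symmetric tensors, and the `else` is void. -/
def multipleIntegral (W : H → Ω → ℝ) (P : Measure Ω) (n : ℕ) (f : HilbertTensorPower n H) :
    Lp ℝ 2 P :=
  if h : symmetrize n H f ∈ (wienerItoMap W P n).domain then wienerItoMap W P n ⟨_, h⟩ else 0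

/-- The Malliavin derivative `D`, a partially defined operator from `L²(Ω)` to `L²(Ω; H)`: the
closure of the operator `φ(W(h₁), …, W(h_k)) ↦ ∑ᵢ ∂ᵢφ(W(h₁), …, W(h_k)) hᵢ`, where `φ` is smooth and
has, with all its derivatives, polynomial growth. -/
def malliavinD (W : H → Ω → ℝ) (P : Measure Ω) : Lp ℝ 2 P →ₗ.[ℝ] Lp H 2 P :=
  (Submodule.span ℝ {p : Lp ℝ 2 P × Lp H 2 P |
    ∃ (k : ℕ) (h : Fin k → H) (φ : (Fin k → ℝ) → ℝ), φ.HasTemperateGrowth ∧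
      (p.1 =ᵐ[P] fun ω => φ (fun i => W (h i) ω)) ∧
      (p.2 =ᵐ[P] fun ω => ∑ i, fderiv ℝ φ (fun i => W (h i) ω) (Pi.single i 1) • h i)}
    ).topologicalClosure.toLinearPMap

/-- The Malliavin matrix of a couple with Malliavin derivatives `X` and `Y`. -/
def malliavinMatrix {P : Measure Ω} (X Y : Lp H 2 P) (ω : Ω) : Matrix (Fin 2) (Fin 2) ℝ :=
  !![‖X ω‖ ^ 2, inner ℝ (X ω) (Y ω); inner ℝ (X ω) (Y ω), ‖Y ω‖ ^ 2]

/-- The coefficient `⟪f, e_{j₁} ⊗ ⋯ ⊗ e_{jₙ}⟫` of `f ∈ H^{⊗n}`. -/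
def coeff {ι : Type*} (e : HilbertBasis ι ℝ H) {n : ℕ} (f : HilbertTensorPower n H)
    (j : Fin n → ι) : ℝ :=
  inner ℝ f (elemTensor fun k => e (j k))

/-- The term of index `j = (j₂, …, jₙ₊₁)` of the series defining `S_{i,f}` (up to the order of the
integral), for `f ∈ H^{⊗(n+1)}`. -/
def chaosTerm (W : H → Ω → ℝ) (P : Measure Ω) {ι : Type*} (e : HilbertBasis ι ℝ H) {n : ℕ}
    (f : HilbertTensorPower (n + 1) H) (i : ι) (j : Fin n → ι) : Lp ℝ 2 P :=
  coeff e f (Fin.cons i j) • multipleIntegral W P n (elemTensor fun k => e (j k))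

/-- `S_{i,f} = (n+1) ∑_{j₂, …, jₙ₊₁} ⟪f, e_i ⊗ e_{j₂} ⊗ ⋯⟫ Iₙ(e_{j₂} ⊗ ⋯ ⊗ e_{jₙ₊₁})` for
`f ∈ H^{⊗(n+1)}`, the series being taken in `L²(Ω)`. -/
def S (W : H → Ω → ℝ) (P : Measure Ω) {ι : Type*} (e : HilbertBasis ι ℝ H) {n : ℕ}
    (f : HilbertTensorPower (n + 1) H) (i : ι) : Lp ℝ 2 P :=
  ((n : ℝ) + 1) • ∑' j : Fin n → ι, chaosTerm W P e f i j

end Wiener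

end MalliavinDet

end

open MalliavinDet

/-! Both `Iₙ` and `D` are defined as closures of graphs, so the proof first identifies these closures.

The integration by parts formula `E[W(h) F] = E[⟪DF, h⟫]` for smooth functionals
(`IsIsonormal.integral_mul_eq`) follows from the one-dimensional formula, because
`W(u) - ⟪h, u⟫ W(h)` is independent of `W(h)`. It has two consequences. The Malliavin derivative is
closable (`IsIsonormal.eq_zero_of_mem_closure_smoothGraph`), and
`E[Hₙ(W(g)) Hₙ(W(h))] = n! ⟪g, h⟫ⁿ` (`IsIsonormal.integral_hermite_mul_hermite`).

By the latter, the families `Hₙ(W(h))` and `(n+1) Hₙ(W(h)) h` have the same Gram kernels, up to a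
constant, as `h^{⊗n}` and `h^{⊗(n+1)}`. So there are continuous linear maps `chaosMap` and `derivMap`
that send the tensors to these variables (`exists_clm_of_inner_eq`). Since the powers of unit vectors
span a dense subspace of the symmetric tensors (`symTensors_le_span_unitPowers`, by polarization),
`Iₙ` is `chaosMap` after symmetrization, and `D Iₙ₊₁(f) = derivMap f` for symmetric `f`.

Continuity also gives `⟪D Iₙ₊₁(f), h⟫ = (n+1) Iₙ(c_h f)`, where `c_h` is the contraction of the first
factor with `h`, because this holds for powers of unit vectors (`innerLp_derivMap`). For `h = e_i`,
the expansion of `c_h f` in the tensor basis is mapped by `Iₙ` to the series `S_{i,f}`, which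
therefore converges unconditionally to `⟪D Iₙ₊₁(f), e_i⟫`. The formula for the determinant is then
Lagrange's identity in `H` (`hasSum_sq_minors`), for almost every `ω`. -/

namespace MalliavinDet

/-! ### Functions of temperate growth and Gaussian vectors -/

section TemperateGrowth

variable {E F : Type*} [NormedAddCommGroup E] [NormedSpace ℝ E]
  [NormedAddCommGroup F] [NormedSpace ℝ F]

theorem hasTemperateGrowth_fderiv {f : E → F} (hf : f.HasTemperateGrowth) :
    (fderiv ℝ f).HasTemperateGrowth := by
  refine ⟨hf.1.fderiv_right (by simp), fun n => ?_⟩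
  obtain ⟨k, C, h⟩ := hf.2 (n + 1)
  exact ⟨k, C, fun x => by rw [norm_iteratedFDeriv_fderiv]; exact h x⟩

theorem hasTemperateGrowth_fderiv_apply {f : E → F} (hf : f.HasTemperateGrowth) (v : E) :
    (fun x => fderiv ℝ f x v).HasTemperateGrowth :=
  (ContinuousLinearMap.apply ℝ F v).hasTemperateGrowth.comp (hasTemperateGrowth_fderiv hf)

theorem hasTemperateGrowth_aeval (p : Polynomial ℤ) :
    (fun x : ℝ => Polynomial.aeval x p).HasTemperateGrowth := by
  induction p using Polynomial.induction_on' with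
  | add p q hp hq =>
    simp only [map_add]
    exact hp.add hq
  | monomial n a =>
    simp only [Polynomial.aeval_monomial]
    fun_prop

theorem memLp_comp_of_hasTemperateGrowth [CompleteSpace E] [SecondCountableTopology E]
    [MeasurableSpace E] [BorelSpace E] {Ω : Type*} [MeasurableSpace Ω] {P : Measure Ω}
    {X : Ω → E} (hX : HasGaussianLaw X P) {f : E → F} (hf : f.HasTemperateGrowth)
    {q : ENNReal} (hq : q ≠ ⊤) : MemLp (fun ω => f (X ω)) q P := by
  have := hX.isProbabilityMeasure
  obtain ⟨k, C, h⟩ := hf.2 0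
  have hY : MemLp (fun ω => 1 + ‖X ω‖) (q * k) P :=
    (memLp_const (1 : ℝ)).add (hX.memLp (ENNReal.mul_ne_top hq (ENNReal.natCast_ne_top k))).norm
  have hZ : MemLp (fun ω => (1 + ‖X ω‖) ^ k) q P := by
    rcases Nat.eq_zero_or_pos k with rfl | hk
    · simp only [pow_zero]
      exact memLp_const (1 : ℝ)
    · have h2 := hY.norm_rpow_div k
      rw [ENNReal.mul_div_cancel_right (by simpa using hk.ne') (by simp)] at h2
      refine h2.ae_eq (Filter.Eventually.of_forall fun ω => ?_)
      have h3 : (0 : ℝ) ≤ 1 + ‖X ω‖ := by positivity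
      simp only [ENNReal.toReal_natCast, Real.rpow_natCast, Real.norm_of_nonneg h3]
  have hm : AEStronglyMeasurable (fun ω => f (X ω)) P :=
    hf.1.continuous.comp_aestronglyMeasurable hX.aemeasurable.aestronglyMeasurable
  refine (hZ.const_mul C).mono hm (Filter.Eventually.of_forall fun ω => ?_)
  have h4 := h (X ω)
  rw [norm_iteratedFDeriv_zero] at h4
  exact h4.trans (le_abs_self _)

end TemperateGrowth

/-! ### Gaussian integration by parts -/

/-- Integration by parts against the standard Gaussian density `p`, which satisfies
`p'(x) = -x p(x)`. -/
theorem integral_id_mul_gaussianReal {f : ℝ → ℝ} (hf : f.HasTemperateGrowth) :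
    ∫ x, x * f x ∂(gaussianReal 0 1) = ∫ x, deriv f x ∂(gaussianReal 0 1) := by
  have hint : ∀ {g : ℝ → ℝ}, g.HasTemperateGrowth →
      Integrable (fun x => g x * gaussianPDFReal 0 1 x) := by
    intro g hg
    have h1 : Integrable g (gaussianReal 0 1) :=
      memLp_one_iff_integrable.1 (memLp_comp_of_hasTemperateGrowth
        (IsGaussian.hasGaussianLaw_id (μ := gaussianReal 0 1)) hg (by simp))
    rw [gaussianReal_of_var_ne_zero _ one_ne_zero, integrable_withDensity_iff_integrable_smul'
      (measurable_gaussianPDF _ _) (Filter.Eventually.of_forall fun _ => gaussianPDF_lt_top)] at h1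
    simpa [mul_comm] using h1
  have hd : (fun x => deriv f x).HasTemperateGrowth := by
    simpa using hasTemperateGrowth_fderiv_apply hf (1 : ℝ)
  have hp : ∀ x, HasDerivAt (gaussianPDFReal 0 1) (-x * gaussianPDFReal 0 1 x) x := by
    intro x
    have h : HasDerivAt (fun x : ℝ => (√(2 * Real.pi * 1))⁻¹ * Real.exp (-(x - 0) ^ 2 / (2 * 1)))
        ((√(2 * Real.pi * 1))⁻¹ * (Real.exp (-(x - 0) ^ 2 / (2 * 1)) *
          (-(2 * (x - 0) ^ 1 * 1) / (2 * 1)))) x := by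
      have h2 : HasDerivAt (fun x : ℝ => (x - 0) ^ 2) (2 * (x - 0) ^ 1 * 1) x := by
        exact (((hasDerivAt_id' x).sub_const 0).fun_pow 2).congr_deriv (by norm_num)
      exact ((h2.neg.div_const _).exp).const_mul _
    simp only [gaussianPDFReal_def, NNReal.coe_one]
    convert h using 1
    ring
  have hfd : ∀ x, HasDerivAt f (deriv f x) x := fun x =>
    (hf.1.differentiable (by simp) x).hasDerivAt
  have key := integral_mul_deriv_eq_deriv_mul_of_integrable
    (u := f) (v := gaussianPDFReal 0 1) (fun x _ => hfd x) (fun x _ => hp x)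
    ?_ (hint hd) (hint hf)
  · rw [integral_gaussianReal_eq_integral_smul one_ne_zero,
      integral_gaussianReal_eq_integral_smul one_ne_zero]
    simp only [smul_eq_mul]
    rw [← neg_inj, ← integral_neg]
    simp_rw [mul_comm (gaussianPDFReal 0 1 _) (deriv f _)]
    rw [← key]
    congr 1
    ext x
    ring
  · have h3 : (fun x => -x * f x).HasTemperateGrowth := by fun_prop
    refine (hint h3).congr (Filter.Eventually.of_forall fun x => ?_)
    simp only [Pi.mul_apply]
    ring

section Isonormal

variable {H : Type*} [NormedAddCommGroup H] [InnerProductSpace ℝ H]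
  {Ω : Type*} [MeasurableSpace Ω] {P : Measure Ω} {W : H → Ω → ℝ}

theorem IsIsonormal.hasGaussianLaw_pi (hW : IsIsonormal W P) {κ : Type*} [Finite κ] (u : κ → H) :
    HasGaussianLaw (fun ω k => W (u k) ω) P := by
  classical
  have := Fintype.ofFinite κ
  -- The vectors `u k` may repeat, so the family is read off the finite set of its values.
  let L : (Finset.univ.image u → ℝ) →L[ℝ] κ → ℝ :=
    ContinuousLinearMap.pi fun k => ContinuousLinearMap.proj ⟨u k, by simp⟩
  exact (hW.isGaussianProcess.hasGaussianLaw (Finset.univ.image u)).map L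

theorem IsIsonormal.memLp (hW : IsIsonormal W P) {κ : Type*} [Fintype κ] (u : κ → H)
    {F : Type*} [NormedAddCommGroup F] [NormedSpace ℝ F] {φ : (κ → ℝ) → F}
    (hφ : φ.HasTemperateGrowth) {q : ENNReal} (hq : q ≠ ⊤) :
    MemLp (fun ω => φ fun k => W (u k) ω) q P :=
  memLp_comp_of_hasTemperateGrowth (hW.hasGaussianLaw_pi u) hφ hq

theorem IsIsonormal.aemeasurable (hW : IsIsonormal W P) (h : H) : AEMeasurable (W h) P :=
  hW.isGaussianProcess.aemeasurable h

theorem IsIsonormal.memLp_apply (hW : IsIsonormal W P) (h : H) {q : ENNReal} (hq : q ≠ ⊤) :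
    MemLp (W h) q P :=
  (hW.isGaussianProcess.hasGaussianLaw_eval h).memLp hq

theorem IsIsonormal.map_eq_gaussianReal (hW : IsIsonormal W P) {h : H} (hh : ‖h‖ = 1) :
    P.map (W h) = gaussianReal 0 1 := by
  have hG := hW.isGaussianProcess.hasGaussianLaw_eval h
  have := hG.isProbabilityMeasure
  rw [hG.map_eq_gaussianReal, hW.centered, variance_eq_sub (hW.memLp_apply h (by simp)),
    hW.centered]
  simp [pow_two, hW.covariance, hh]

/-- For a unit vector `h`, the remainders `W(u_k) - ⟪h, u_k⟫ W(h)` are uncorrelated with `W(h)`,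
hence independent of it. -/
theorem IsIsonormal.indepFun_sub (hW : IsIsonormal W P) {h : H} (hh : ‖h‖ = 1)
    {κ : Type*} [Finite κ] (u : κ → H) :
    IndepFun (W h) (fun ω k => W (u k) ω - inner ℝ h (u k) * W h ω) P := by
  classical
  have := Fintype.ofFinite κ
  have := (hW.isGaussianProcess.hasGaussianLaw_eval h).isProbabilityMeasure
  have hm := hW.aemeasurable
  have hproc : IsGaussianProcess (Sum.elim (fun _ : Unit => W h)
      (fun k ω => W (u k) ω - inner ℝ h (u k) * W h ω)) P := by
    refine hW.isGaussianProcess.of_isGaussianProcess fun s => ?_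
    rcases s with s | k
    · exact ⟨{h}, ContinuousLinearMap.proj ⟨h, by simp⟩, fun ω => by simp⟩
    · exact ⟨{h, u k}, ContinuousLinearMap.proj ⟨u k, by simp⟩ -
        inner ℝ h (u k) • ContinuousLinearMap.proj ⟨h, by simp⟩, fun ω => by simp⟩
  have hind := hproc.indepFun_of_covariance_eq_zero (fun _ => hm h)
    (fun k => (hm (u k)).sub ((hm h).const_mul _)) fun _ k => by
      have h2 : ∀ g, MemLp (W g) 2 P := fun g => hW.memLp_apply g (by simp)
      have h3 : ∀ g g', Integrable (fun ω => W g ω * W g' ω) P := fun g g' =>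
        (h2 g).integrable_mul (h2 g')
      have h4 : MemLp (fun ω => W (u k) ω - inner ℝ h (u k) * W h ω) 2 P :=
        (h2 (u k)).sub ((h2 h).const_mul _)
      rw [covariance_eq_sub (h2 h) h4, hW.centered]
      simp only [Pi.mul_apply, mul_sub, zero_mul, sub_zero, mul_left_comm (W h _)]
      rw [integral_sub (h3 _ _) ((h3 _ _).const_mul _), integral_const_mul, hW.covariance,
        hW.covariance, real_inner_self_eq_norm_sq, hh]
      ring
  exact hind.comp (measurable_pi_apply ()) measurable_id

/-- Integration by parts for an isonormal process:
`E[W(h) F] = E[⟪DF, h⟫]` for `F = φ(W(u₁), …, W(u_k))` and a unit vector `h`. It reduces to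
dimension one by conditioning on the part of `(W(u₁), …, W(u_k))` independent of `W(h)`. -/
theorem IsIsonormal.integral_mul_eq (hW : IsIsonormal W P) {h : H} (hh : ‖h‖ = 1)
    {κ : Type*} [Fintype κ] (u : κ → H) {φ : (κ → ℝ) → ℝ} (hφ : φ.HasTemperateGrowth) :
    ∫ ω, W h ω * φ (fun k => W (u k) ω) ∂P =
      ∫ ω, fderiv ℝ φ (fun k => W (u k) ω) (fun k => inner ℝ h (u k)) ∂P := by
  have := (hW.isGaussianProcess.hasGaussianLaw_eval h).isProbabilityMeasure
  set a : κ → ℝ := fun k => inner ℝ h (u k) with ha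
  set Y : Ω → κ → ℝ := fun ω k => W (u k) ω - a k * W h ω with hY
  have hm := hW.aemeasurable
  have hYm : AEMeasurable Y P := aemeasurable_pi_lambda _ fun k =>
    (hm (u k)).sub ((hm h).const_mul _)
  have hsplit : ∀ ω, (fun k => W (u k) ω) = W h ω • a + Y ω := by
    intro ω
    ext k
    simp only [hY, Pi.add_apply, Pi.smul_apply, smul_eq_mul]
    ring
  -- `W(h)` and `Y` are independent, so that Fubini's theorem applies.
  have hlaw : P.map (fun ω => (W h ω, Y ω)) = (gaussianReal 0 1).prod (P.map Y) := by
    rw [(hW.indepFun_sub hh u).map_prod_eq_prod_map_map (hm h) hYm, hW.map_eq_gaussianReal hh]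
  have := Measure.isProbabilityMeasure_map (μ := P) hYm
  have hfub : ∀ g : ℝ × (κ → ℝ) → ℝ, Continuous g →
      Integrable (fun ω => g (W h ω, Y ω)) P →
      ∫ ω, g (W h ω, Y ω) ∂P = ∫ y, ∫ x, g (x, y) ∂(gaussianReal 0 1) ∂(P.map Y) := by
    intro g hg hi
    have hp : AEMeasurable (fun ω => (W h ω, Y ω)) P := (hm h).prodMk hYm
    rw [← integral_map hp hg.aestronglyMeasurable, hlaw, integral_prod_symm]
    rw [← hlaw]
    exact (integrable_map_measure hg.aestronglyMeasurable hp).2 hi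
  have hd := hasTemperateGrowth_fderiv_apply hφ a
  have hφc := hφ.1.continuous
  have hdc := hd.1.continuous
  have e1 := hfub (fun p => p.1 * φ (p.1 • a + p.2)) (by fun_prop) (by
    simp only [← hsplit]
    exact (hW.memLp_apply h (q := 2) (by simp)).integrable_mul
      (hW.memLp u hφ (q := 2) (by simp)))
  have e2 := hfub (fun p => fderiv ℝ φ (p.1 • a + p.2) a)
    (hdc.comp (by fun_prop : Continuous fun p : ℝ × (κ → ℝ) => p.1 • a + p.2)) (by
    simp only [← hsplit]
    exact memLp_one_iff_integrable.1 (hW.memLp u hd (by simp)))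
  simp only [← hsplit] at e1 e2
  rw [e1, e2]
  congr 1
  ext y
  have hline : (fun x : ℝ => φ (x • a + y)).HasTemperateGrowth :=
    hφ.comp (by fun_prop : (fun x : ℝ => x • a + y).HasTemperateGrowth)
  rw [integral_id_mul_gaussianReal hline]
  congr 1
  ext x
  have h1 : HasDerivAt (fun x : ℝ => x • a + y) a x := by
    simpa using ((hasDerivAt_id x).smul_const a).add_const y
  exact ((hφ.1.differentiable (by simp) _).hasFDerivAt.comp_hasDerivAt x h1).deriv

end Isonormal

/-! ### Hermite polynomials of an isonormal process -/

theorem derivative_hermite_succ (n : ℕ) :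
    Polynomial.derivative (Polynomial.hermite (n + 1)) =
      ((n : Polynomial ℤ) + 1) * Polynomial.hermite n := by
  induction n with
  | zero => simp
  | succ n ih =>
    rw [Polynomial.hermite_succ (n + 1), Polynomial.derivative_sub, Polynomial.derivative_mul, ih,
      Polynomial.derivative_mul, Polynomial.hermite_succ n]
    simp
    ring

section Isonormal

variable {H : Type*} [NormedAddCommGroup H] [InnerProductSpace ℝ H]
  {Ω : Type*} [MeasurableSpace Ω] {P : Measure Ω} {W : H → Ω → ℝ}

theorem IsIsonormal.memLp_aeval (hW : IsIsonormal W P) (h : H) (p : Polynomial ℤ)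
    {q : ENNReal} (hq : q ≠ ⊤) : MemLp (fun ω => Polynomial.aeval (W h ω) p) q P :=
  memLp_comp_of_hasTemperateGrowth (hW.isGaussianProcess.hasGaussianLaw_eval h)
    (hasTemperateGrowth_aeval p) hq

theorem IsIsonormal.integrable_aeval_mul_aeval (hW : IsIsonormal W P) (g h : H)
    (p q : Polynomial ℤ) :
    Integrable (fun ω => Polynomial.aeval (W g ω) p * Polynomial.aeval (W h ω) q) P :=
  (hW.memLp_aeval g p (q := 2) (by simp)).integrable_mul (hW.memLp_aeval h q (q := 2) (by simp))

theorem hasTemperateGrowth_aeval_apply {κ : Type*} [Fintype κ] (k : κ) (p : Polynomial ℤ) :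
    (fun x : κ → ℝ => Polynomial.aeval (x k) p).HasTemperateGrowth :=
  (hasTemperateGrowth_aeval p).comp
    (ContinuousLinearMap.proj (R := ℝ) (φ := fun _ : κ => ℝ) k).hasTemperateGrowth

theorem hasFDerivAt_aeval_apply {κ : Type*} [Fintype κ] (k : κ) (p : Polynomial ℤ) (x : κ → ℝ) :
    HasFDerivAt (fun x : κ → ℝ => Polynomial.aeval (x k) p)
      (Polynomial.aeval (x k) (Polynomial.derivative p) •
        ContinuousLinearMap.proj (R := ℝ) (φ := fun _ : κ => ℝ) k) x :=
  HasDerivAt.comp_hasFDerivAt (f := fun x : κ → ℝ => x k) x (p.hasDerivAt_aeval (x k))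
    (ContinuousLinearMap.proj (R := ℝ) (φ := fun _ : κ => ℝ) k).hasFDerivAt

theorem IsIsonormal.integral_mul_aeval_mul_aeval (hW : IsIsonormal W P) {g : H} (hg : ‖g‖ = 1)
    (h : H) (p q : Polynomial ℤ) :
    ∫ ω, W g ω * (Polynomial.aeval (W g ω) p * Polynomial.aeval (W h ω) q) ∂P =
      ∫ ω, Polynomial.aeval (W g ω) (Polynomial.derivative p) * Polynomial.aeval (W h ω) q ∂P +
        inner ℝ g h *
        ∫ ω, Polynomial.aeval (W g ω) p * Polynomial.aeval (W h ω) (Polynomial.derivative q) ∂P := by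
  have hφ := (hasTemperateGrowth_aeval_apply (0 : Fin 2) p).mul
    (hasTemperateGrowth_aeval_apply (1 : Fin 2) q)
  have key := hW.integral_mul_eq hg ![g, h] hφ
  have hd := fun x : Fin 2 → ℝ => ((hasFDerivAt_aeval_apply 0 p x).mul
    (hasFDerivAt_aeval_apply 1 q x)).fderiv
  have hd' : fderiv ℝ ((fun x : Fin 2 → ℝ => Polynomial.aeval (x 0) p) *
      (fun x : Fin 2 → ℝ => Polynomial.aeval (x 1) q)) = _ := funext hd
  rw [hd'] at key
  simp only [Pi.mul_apply, Matrix.cons_val_zero, Matrix.cons_val_one] at key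
  rw [key, ← integral_const_mul, ← integral_add (hW.integrable_aeval_mul_aeval _ _ _ _)
    ((hW.integrable_aeval_mul_aeval _ _ _ _).const_mul _)]
  congr 1
  ext ω
  simp [hg]
  ring

/-- The covariances of Hermite polynomials of Gaussian variables:
`E[Hₙ(W(g)) Hₙ(W(h))] = n! ⟪g, h⟫ⁿ` for unit vectors `g` and `h`. -/
theorem IsIsonormal.integral_hermite_mul_hermite (hW : IsIsonormal W P) {g h : H}
    (hg : ‖g‖ = 1) (n : ℕ) :
    ∫ ω, Polynomial.aeval (W g ω) (Polynomial.hermite n) *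
        Polynomial.aeval (W h ω) (Polynomial.hermite n) ∂P =
      n.factorial * inner ℝ g h ^ n := by
  have := (hW.isGaussianProcess.hasGaussianLaw_eval g).isProbabilityMeasure
  induction n with
  | zero => simp
  | succ n ih =>
    have key := hW.integral_mul_aeval_mul_aeval hg h (Polynomial.hermite n)
      (Polynomial.hermite (n + 1))
    have h1 : ∀ ω, Polynomial.aeval (W g ω) (Polynomial.hermite (n + 1)) *
        Polynomial.aeval (W h ω) (Polynomial.hermite (n + 1)) =
        W g ω * (Polynomial.aeval (W g ω) (Polynomial.hermite n) *
          Polynomial.aeval (W h ω) (Polynomial.hermite (n + 1))) -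
        Polynomial.aeval (W g ω) (Polynomial.derivative (Polynomial.hermite n)) *
          Polynomial.aeval (W h ω) (Polynomial.hermite (n + 1)) := by
      intro ω
      rw [Polynomial.hermite_succ n]
      simp only [map_sub, map_mul, Polynomial.aeval_X]
      ring
    have h2 : Integrable (fun ω => W g ω * (Polynomial.aeval (W g ω) (Polynomial.hermite n) *
        Polynomial.aeval (W h ω) (Polynomial.hermite (n + 1)))) P := by
      have := hW.integrable_aeval_mul_aeval g h (Polynomial.X * Polynomial.hermite n)
        (Polynomial.hermite (n + 1))
      simpa [mul_assoc] using this
    simp_rw [h1]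
    rw [integral_sub h2 (hW.integrable_aeval_mul_aeval _ _ _ _), key, add_sub_cancel_left,
      derivative_hermite_succ]
    have h3 : ∀ ω, Polynomial.aeval (W g ω) (Polynomial.hermite n) *
        Polynomial.aeval (W h ω) (((n : Polynomial ℤ) + 1) * Polynomial.hermite n) =
        ((n : ℝ) + 1) * (Polynomial.aeval (W g ω) (Polynomial.hermite n) *
          Polynomial.aeval (W h ω) (Polynomial.hermite n)) := by
      intro ω
      simp only [map_mul, map_add, map_natCast, map_one]
      ring
    simp_rw [h3]
    rw [integral_const_mul, ih, Nat.factorial_succ]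
    push_cast
    ring

/-! ### Closability of the Malliavin derivative -/

theorem inner_sum_fderiv_smul {κ : Type*} [Fintype κ] {φ : (κ → ℝ) → ℝ} (x : κ → ℝ) (u : κ → H)
    (h : H) [DecidableEq κ] :
    inner ℝ h (∑ i, fderiv ℝ φ x (Pi.single i 1) • u i) =
      fderiv ℝ φ x (fun k => inner ℝ h (u k)) := by
  rw [inner_sum, ← ContinuousLinearMap.coe_coe (fderiv ℝ φ x),
    LinearMap.pi_apply_eq_sum_univ (fderiv ℝ φ x).toLinearMap]
  refine Finset.sum_congr rfl fun i _ => ?_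
  rw [inner_smul_right, smul_eq_mul, mul_comm]
  congr 3
  ext j
  simp [Pi.single_apply, eq_comm]

/-- The graph of the Malliavin derivative on smooth functionals `φ(W(h₁), …, W(h_k))`. -/
def smoothGraph (W : H → Ω → ℝ) (P : Measure Ω) : Set (Lp ℝ 2 P × Lp H 2 P) :=
  {p | ∃ (k : ℕ) (h : Fin k → H) (φ : (Fin k → ℝ) → ℝ), φ.HasTemperateGrowth ∧
    (p.1 =ᵐ[P] fun ω => φ (fun i => W (h i) ω)) ∧
    (p.2 =ᵐ[P] fun ω => ∑ i, fderiv ℝ φ (fun i => W (h i) ω) (Pi.single i 1) • h i)}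

/-- The smooth functionals `φ(W(h₁), …, W(h_k))`, as elements of `L²(Ω)`. -/
def smoothFunctionals (W : H → Ω → ℝ) (P : Measure Ω) : Set (Lp ℝ 2 P) :=
  {F | ∃ (k : ℕ) (h : Fin k → H) (φ : (Fin k → ℝ) → ℝ), φ.HasTemperateGrowth ∧
    F =ᵐ[P] fun ω => φ (fun i => W (h i) ω)}

/-- The pointwise scalar product with `h`, from `L²(Ω; H)` to `L²(Ω)`. -/
noncomputable def innerLp (P : Measure Ω) (h : H) : Lp H 2 P →L[ℝ] Lp ℝ 2 P :=
  (innerSL ℝ h).compLpL 2 P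

theorem coeFn_innerLp (h : H) (X : Lp H 2 P) :
    innerLp P h X =ᵐ[P] fun ω => inner ℝ h (X ω) :=
  (innerSL ℝ h).coeFn_compLp X

theorem innerLp_ae_eq_fderiv {k : ℕ} {u : Fin k → H} {φ : (Fin k → ℝ) → ℝ}
    {X : Lp H 2 P}
    (hX : X =ᵐ[P] fun ω => ∑ i, fderiv ℝ φ (fun i => W (u i) ω) (Pi.single i 1) • u i) (h : H) :
    innerLp P h X =ᵐ[P] fun ω => fderiv ℝ φ (fun i => W (u i) ω) (fun i => inner ℝ h (u i)) := by
  filter_upwards [coeFn_innerLp h X, hX] with ω h1 h2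
  rw [h1, h2, inner_sum_fderiv_smul]

/-- Integration by parts for a product of two smooth functionals `F` and `A`:
`E[A ⟪DF, h⟫] = E[(A W(h) - ⟪DA, h⟫) F]`. The weight `B = A W(h) - ⟪DA, h⟫` does not depend on
`F`. -/
theorem IsIsonormal.exists_inner_innerLp_eq (hW : IsIsonormal W P) {h : H} (hh : ‖h‖ = 1)
    {A : Lp ℝ 2 P} (hA : A ∈ smoothFunctionals W P) :
    ∃ B : Lp ℝ 2 P, ∀ p ∈ smoothGraph W P, inner ℝ A (innerLp P h p.2) = inner ℝ B p.1 := by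
  obtain ⟨l, v, ψ, hψ, hAψ⟩ := hA
  set b : Fin l → ℝ := fun i => inner ℝ h (v i)
  have hψd := hasTemperateGrowth_fderiv_apply hψ b
  have hB : MemLp (fun ω => W h ω * ψ (fun i => W (v i) ω) -
      fderiv ℝ ψ (fun i => W (v i) ω) b) 2 P := by
    refine MemLp.sub ?_ (hW.memLp v hψd (by simp))
    -- `W(h) A` is a smooth functional of the family extended by `h`, which has index `none`.
    have hp : (fun x : Option (Fin l) → ℝ => x none * ψ (fun i => x (some i))).HasTemperateGrowth :=
      (ContinuousLinearMap.proj (R := ℝ) (φ := fun _ : Option (Fin l) => ℝ)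
        none).hasTemperateGrowth.mul (hψ.comp (ContinuousLinearMap.pi fun i : Fin l =>
          ContinuousLinearMap.proj (R := ℝ) (φ := fun _ : Option (Fin l) => ℝ)
            (some i)).hasTemperateGrowth)
    exact hW.memLp (fun o : Option (Fin l) => o.elim h v) hp (by simp)
  refine ⟨hB.toLp, ?_⟩
  rintro ⟨F, X⟩ ⟨k, u, φ, hφ, hF, hX⟩
  dsimp only at hF hX ⊢
  set a : Fin k → ℝ := fun i => inner ℝ h (u i)
  have hφd := hasTemperateGrowth_fderiv_apply hφ a
  -- The product `F A` is a smooth functional of the joined families `u` and `v`.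
  let L : (Fin k ⊕ Fin l → ℝ) →L[ℝ] (Fin k → ℝ) :=
    ContinuousLinearMap.pi fun i => ContinuousLinearMap.proj (Sum.inl i)
  let R : (Fin k ⊕ Fin l → ℝ) →L[ℝ] (Fin l → ℝ) :=
    ContinuousLinearMap.pi fun i => ContinuousLinearMap.proj (Sum.inr i)
  have hΦ := (hφ.comp L.hasTemperateGrowth).mul (hψ.comp R.hasTemperateGrowth)
  have hd : ∀ z, fderiv ℝ ((φ ∘ L) * (ψ ∘ R)) z = _ := fun z =>
    (((hφ.1.differentiable (by simp) (L z)).hasFDerivAt.comp z L.hasFDerivAt).mul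
      ((hψ.1.differentiable (by simp) (R z)).hasFDerivAt.comp z R.hasFDerivAt)).fderiv
  have key := hW.integral_mul_eq hh (Sum.elim u v) hΦ
  have hd' : fderiv ℝ ((φ ∘ L) * (ψ ∘ R)) = _ := funext hd
  rw [hd'] at key
  have i1 : Integrable (fun ω => ψ (fun i => W (v i) ω) *
      fderiv ℝ φ (fun i => W (u i) ω) a) P :=
    (hW.memLp v hψ (q := 2) (by simp)).integrable_mul (hW.memLp u hφd (q := 2) (by simp))
  have i2 : Integrable (fun ω => fderiv ℝ ψ (fun i => W (v i) ω) b *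
      φ (fun i => W (u i) ω)) P :=
    (hW.memLp v hψd (q := 2) (by simp)).integrable_mul (hW.memLp u hφ (q := 2) (by simp))
  have i3 : Integrable (fun ω => (W h ω * ψ (fun i => W (v i) ω) -
      fderiv ℝ ψ (fun i => W (v i) ω) b) * φ (fun i => W (u i) ω)) P :=
    hB.integrable_mul (hW.memLp u hφ (q := 2) (by simp))
  have key' : ∫ ω, W h ω * (φ (fun i => W (u i) ω) * ψ (fun i => W (v i) ω)) ∂P =
      ∫ ω, (ψ (fun i => W (v i) ω) * fderiv ℝ φ (fun i => W (u i) ω) a +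
        fderiv ℝ ψ (fun i => W (v i) ω) b * φ (fun i => W (u i) ω)) ∂P := by
    refine key.trans (integral_congr_ae (Filter.Eventually.of_forall fun ω => ?_))
    change φ (fun i => W (u i) ω) * fderiv ℝ ψ (fun i => W (v i) ω) b +
      ψ (fun i => W (v i) ω) * fderiv ℝ φ (fun i => W (u i) ω) a = _
    ring
  rw [L2.inner_def, L2.inner_def]
  have e1 : ∫ ω, inner ℝ (A ω) (innerLp P h X ω) ∂P =
      ∫ ω, ψ (fun i => W (v i) ω) * fderiv ℝ φ (fun i => W (u i) ω) a ∂P := by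
    refine integral_congr_ae ?_
    filter_upwards [hAψ, innerLp_ae_eq_fderiv hX h] with ω h1 h2
    rw [h1, h2, real_inner_comm, RCLike.inner_apply, conj_trivial]
  have e2 : ∫ ω, inner ℝ (hB.toLp _ ω) (F ω) ∂P =
      ∫ ω, (W h ω * ψ (fun i => W (v i) ω) -
      fderiv ℝ ψ (fun i => W (v i) ω) b) * φ (fun i => W (u i) ω) ∂P := by
    refine integral_congr_ae ?_
    filter_upwards [hB.coeFn_toLp, hF] with ω h1 h2
    rw [h1, h2, real_inner_comm, RCLike.inner_apply, conj_trivial]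
  rw [e1, e2]
  rw [integral_add i1 i2] at key'
  have e3 := integral_add i3 i2
  rw [eq_comm, ← add_left_inj, ← e3, ← key']
  refine integral_congr_ae (Filter.Eventually.of_forall fun ω => ?_)
  dsimp only
  ring

/-- The Malliavin derivative is closable. If `(0, X)` is a limit of pairs `(Fₙ, DFₙ)`, then
integration by parts makes `⟪X, h⟫` orthogonal to all smooth functionals; but `⟪X, h⟫` is a limit
of the smooth functionals `⟪DFₙ, h⟫`, so that it vanishes. -/
theorem IsIsonormal.eq_zero_of_mem_closure_smoothGraph [SeparableSpace H] (hW : IsIsonormal W P)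
    {p : Lp ℝ 2 P × Lp H 2 P}
    (hp : p ∈ (Submodule.span ℝ (smoothGraph W P)).topologicalClosure) (hp1 : p.1 = 0) :
    p.2 = 0 := by
  have hunit : ∀ h : H, ‖h‖ = 1 → innerLp P h p.2 = 0 := by
    intro h hh
    have hcl : innerLp P h p.2 ∈
        (Submodule.span ℝ (smoothFunctionals W P)).topologicalClosure := by
      refine map_mem_closure (f := fun p : Lp ℝ 2 P × Lp H 2 P => innerLp P h p.2)
        (by fun_prop) hp ?_
      intro q hq
      refine Submodule.span_induction (p := fun q _ => innerLp P h q.2 ∈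
        Submodule.span ℝ (smoothFunctionals W P)) ?_ ?_ ?_ ?_ hq
      · rintro q ⟨k, u, φ, hφ, -, hX⟩
        exact Submodule.subset_span ⟨k, u, _, hasTemperateGrowth_fderiv_apply hφ _,
          innerLp_ae_eq_fderiv hX h⟩
      · simp
      · intro x y _ _ hx hy
        simpa using add_mem hx hy
      · intro c x _ hx
        simpa using Submodule.smul_mem _ c hx
    have hort : ∀ A ∈ smoothFunctionals W P, inner ℝ A (innerLp P h p.2) = 0 := by
      intro A hA
      obtain ⟨B, hB⟩ := hW.exists_inner_innerLp_eq hh hA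
      have : inner ℝ A (innerLp P h p.2) = inner ℝ B p.1 := by
        have hcl : IsClosed {q : Lp ℝ 2 P × Lp H 2 P |
            inner ℝ A (innerLp P h q.2) = inner ℝ B q.1} :=
          isClosed_eq (by fun_prop) (by fun_prop)
        refine closure_minimal ?_ hcl hp
        intro q hq
        refine Submodule.span_induction (p := fun q _ =>
          inner ℝ A (innerLp P h q.2) = inner ℝ B q.1) hB (by simp) ?_ ?_ hq
        · intro x y _ _ hx hy
          simp [inner_add_right, hx, hy]
        · intro c x _ hx
          simp [inner_smul_right, hx]
      rw [this, hp1, inner_zero_right]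
    have hker : (Submodule.span ℝ (smoothFunctionals W P)).topologicalClosure ≤
        LinearMap.ker (innerSL ℝ (innerLp P h p.2)).toLinearMap := by
      refine Submodule.topologicalClosure_minimal _ (Submodule.span_le.2 fun A hA => ?_)
        (innerSL ℝ (innerLp P h p.2)).isClosed_ker
      simpa [real_inner_comm] using hort A hA
    simpa using hker hcl
  refine Lp.ext ?_
  refine (ae_eq_zero_of_forall_inner (𝕜 := ℝ) fun c => ?_).trans (Lp.coeFn_zero _ _ _).symm
  rcases eq_or_ne c 0 with rfl | hc
  · simp only [inner_zero_left]
    rfl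
  · have h1 := hunit (‖c‖⁻¹ • c) (norm_smul_inv_norm hc)
    have h2 := coeFn_innerLp (‖c‖⁻¹ • c) p.2
    rw [h1] at h2
    filter_upwards [h2, Lp.coeFn_zero ℝ 2 P] with ω h3 h4
    rw [h4] at h3
    simpa [inner_smul_left, hc] using h3.symm

end Isonormal

/-! ### Linear maps prescribed on a family of vectors -/

/-- If the Gram kernel of a family `w` is `C` times that of `v`, then some continuous linear map
sends `v a` to `w a` for all `a`. -/
theorem exists_clm_of_inner_eq {α E F : Type*} [NormedAddCommGroup E] [InnerProductSpace ℝ E]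
    [CompleteSpace E] [NormedAddCommGroup F] [InnerProductSpace ℝ F] [CompleteSpace F]
    (v : α → E) (w : α → F) (C : ℝ)
    (h : ∀ a b, inner ℝ (w a) (w b) = C * inner ℝ (v a) (v b)) :
    ∃ T : E →L[ℝ] F, ∀ a, T (v a) = w a := by
  let V := Finsupp.linearCombination ℝ v
  let V' := Finsupp.linearCombination ℝ w
  have hVW : ∀ x y, inner ℝ (V' x) (V' y) = C * inner ℝ (V x) (V y) := by
    intro x y
    simp only [V, V', Finsupp.linearCombination_apply, Finsupp.sum, sum_inner, inner_sum,
      inner_smul_left, inner_smul_right, h, Finset.mul_sum]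
    refine Finset.sum_congr rfl fun a _ => Finset.sum_congr rfl fun b _ => ?_
    ring
  let K := V.range.topologicalClosure
  let V₁ : (α →₀ ℝ) →ₗ[ℝ] K := V.codRestrict K fun x =>
    V.range.le_topologicalClosure ⟨x, rfl⟩
  have hd : DenseRange V₁ := by
    intro x
    rw [Topology.IsInducing.subtypeVal.closure_eq_preimage_closure_image]
    refine closure_mono ?_ x.2
    rintro _ ⟨y, rfl⟩
    exact ⟨V₁ y, ⟨y, rfl⟩, rfl⟩
  have hn : ∃ c, ∀ x, ‖V' x‖ ≤ c * ‖V₁ x‖ := by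
    refine ⟨√C, fun x => ?_⟩
    have h1 := hVW x x
    rw [real_inner_self_eq_norm_sq, real_inner_self_eq_norm_sq] at h1
    have h2 : ‖V₁ x‖ = ‖V x‖ := rfl
    rw [h2, ← Real.sqrt_sq (norm_nonneg (V' x)), h1, Real.sqrt_mul' _ (sq_nonneg _),
      Real.sqrt_sq (norm_nonneg _)]
  have : CompleteSpace K := V.range.isClosed_topologicalClosure.completeSpace_coe
  refine ⟨V'.extendOfNorm V₁ ∘L K.orthogonalProjectionOnto, fun a => ?_⟩
  have h1 : V₁ (Finsupp.single a 1) = ⟨v a, V.range.le_topologicalClosure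
      ⟨Finsupp.single a 1, by simp [V]⟩⟩ := Subtype.ext (by simp [V₁, V])
  have h2 : K.orthogonalProjectionOnto (v a) = V₁ (Finsupp.single a 1) := by
    rw [h1]
    exact K.orthogonalProjectionOnto_mem_subspace_eq_self ⟨v a, _⟩
  rw [ContinuousLinearMap.comp_apply, h2, LinearMap.extendOfNorm_eq hd hn]
  simp [V']

/-! ### Elementary tensors -/

section Tensors

variable {n : ℕ} {H : Type*} [NormedAddCommGroup H] [InnerProductSpace ℝ H]

theorem norm_elemTensor (x : Fin n → H) : ‖elemTensor x‖ = ∏ k, ‖x k‖ := by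
  rw [← sq_eq_sq₀ (norm_nonneg _) (by positivity), ← real_inner_self_eq_norm_sq,
    inner_elemTensor, ← Finset.prod_pow]
  simp only [real_inner_self_eq_norm_sq]

/-- The coefficients of a tensor against elementary tensors, as a continuous multilinear form. -/
noncomputable def tensorForm (f : HilbertTensorPower n H) : H [×n]→L[ℝ] ℝ :=
  MultilinearMap.mkContinuous
    (((innerSL ℝ f) ∘L (UniformSpace.Completion.toComplL :
      AlgTensorPower n H →L[ℝ] _)).toLinearMap.compMultilinearMap (algTprod n H)) ‖f‖
    fun x => by
      rw [← norm_elemTensor]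
      exact norm_inner_le_norm (𝕜 := ℝ) f (elemTensor x)

theorem eq_zero_of_inner_elemTensor {f : HilbertTensorPower n H}
    (h : ∀ x : Fin n → H, inner ℝ f (elemTensor x) = 0) : f = 0 := by
  have h1 : ∀ g : HilbertTensorPower n H, inner ℝ f g = 0 := by
    intro g
    induction g using UniformSpace.Completion.induction_on with
    | hp => exact isClosed_eq (by fun_prop) (by fun_prop)
    | ih t =>
      obtain ⟨N, c, x, rfl⟩ : ∃ (N : ℕ) (c : Fin N → ℝ) (x : Fin N → Fin n → H),
          t = ∑ a, c a • algTprod n H (x a) := exists_eq_sum n H t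
      have h2 := map_sum (UniformSpace.Completion.toComplL : AlgTensorPower n H →L[ℝ] _)
        (fun a => c a • algTprod n H (x a)) Finset.univ
      simp only [map_smul, UniformSpace.Completion.coe_toComplL] at h2
      rw [h2, inner_sum]
      exact Finset.sum_eq_zero fun a _ => by
        rw [inner_smul_right]
        exact mul_eq_zero_of_right _ (h (x a))
  exact inner_self_eq_zero.1 (h1 f)

theorem ext_inner_elemTensor {f g : HilbertTensorPower n H}
    (h : ∀ x : Fin n → H, inner ℝ f (elemTensor x) = inner ℝ g (elemTensor x)) : f = g :=
  sub_eq_zero.1 (eq_zero_of_inner_elemTensor fun x => by rw [inner_sub_left, h, sub_self])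

/-- A tensor is determined by its coefficients in the tensor basis: the basis vectors are replaced
by arbitrary vectors one factor at a time. -/
theorem eq_zero_of_inner_elemTensor_basis {ι : Type*} (e : HilbertBasis ι ℝ H)
    {f : HilbertTensorPower n H}
    (h : ∀ j : Fin n → ι, inner ℝ f (elemTensor fun k => e (j k)) = 0) : f = 0 := by
  have key : ∀ (s : Finset (Fin n)) (x : Fin n → H), (∀ k ∉ s, x k ∈ Set.range e) →
      tensorForm f x = 0 := by
    intro s
    induction s using Finset.induction_on with
    | empty =>
      intro x hx
      choose j hj using fun k => hx k (Finset.notMem_empty k)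
      obtain rfl : (fun k => e (j k)) = x := funext hj
      exact h j
    | insert k s hk ih =>
      intro x hx
      have h0 : (tensorForm f).toContinuousLinearMap x k = 0 := by
        refine ContinuousLinearMap.ext_on (s := Set.range e)
          ((Submodule.dense_iff_topologicalClosure_eq_top).2 e.dense_span) ?_
        rintro _ ⟨i, rfl⟩
        refine ih _ fun l hl => ?_
        rcases eq_or_ne l k with rfl | hlk
        · simp
        · rw [Function.update_of_ne hlk]
          exact hx l (by simp [hlk, hl])
      have h1 := DFunLike.congr_fun h0 (x k)
      simpa using h1
  exact eq_zero_of_inner_elemTensor fun x => key Finset.univ x (by simp)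

/-- The expansion of a tensor in the tensor basis `e_{j₁} ⊗ ⋯ ⊗ e_{jₙ}`. -/
theorem hasSum_coeff_smul_elemTensor {ι : Type*} (e : HilbertBasis ι ℝ H)
    (f : HilbertTensorPower n H) :
    HasSum (fun j : Fin n → ι => coeff e f j • elemTensor fun k => e (j k)) f := by
  classical
  have ho : Orthonormal ℝ fun j : Fin n → ι => elemTensor fun k => e (j k) := by
    rw [orthonormal_iff_ite]
    intro i j
    rw [inner_elemTensor]
    simp only [orthonormal_iff_ite.1 e.orthonormal]
    rw [Finset.prod_ite_zero]
    simp [funext_iff]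
  have hs : (Submodule.span ℝ (Set.range fun j : Fin n → ι =>
      elemTensor fun k => e (j k)))ᗮ = ⊥ := by
    rw [eq_bot_iff]
    intro g hg
    rw [Submodule.mem_orthogonal'] at hg
    exact eq_zero_of_inner_elemTensor_basis e fun j => hg _ (Submodule.subset_span ⟨j, rfl⟩)
  have := (HilbertBasis.mkOfOrthogonalEqBot ho hs).hasSum_repr f
  simp only [HilbertBasis.repr_apply_apply, HilbertBasis.coe_mkOfOrthogonalEqBot] at this
  simpa only [coeff, real_inner_comm] using this

theorem exists_contraction (h : H) :
    ∃ c : HilbertTensorPower (n + 1) H →L[ℝ] HilbertTensorPower n H,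
      ∀ f x, inner ℝ (c f) (elemTensor x) =
        inner ℝ f (elemTensor (Fin.cons h x : Fin (n + 1) → H)) := by
  obtain ⟨T, hT⟩ := exists_clm_of_inner_eq (fun x : Fin n → H => elemTensor x)
    (fun x => elemTensor (Fin.cons h x : Fin (n + 1) → H)) (inner ℝ h h) fun x y => by
      simp [inner_elemTensor, Fin.prod_univ_succ]
  exact ⟨T.adjoint, fun f x => by rw [ContinuousLinearMap.adjoint_inner_left, hT]⟩

/-- The contraction of the first factor of a tensor with `h`, which is adjoint to
`x₂ ⊗ ⋯ ⊗ xₙ₊₁ ↦ h ⊗ x₂ ⊗ ⋯ ⊗ xₙ₊₁`. -/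
noncomputable def contraction (h : H) :
    HilbertTensorPower (n + 1) H →L[ℝ] HilbertTensorPower n H :=
  (exists_contraction h).choose

theorem inner_contraction (h : H) (f : HilbertTensorPower (n + 1) H) (x : Fin n → H) :
    inner ℝ (contraction h f) (elemTensor x) =
      inner ℝ f (elemTensor (Fin.cons h x : Fin (n + 1) → H)) :=
  (exists_contraction h).choose_spec f x

theorem contraction_elemTensor (h g : H) :
    contraction h (elemTensor fun _ : Fin (n + 1) => g) =
      inner ℝ g h • elemTensor fun _ : Fin n => g := by
  refine ext_inner_elemTensor fun x => ?_
  simp [inner_contraction, inner_elemTensor, inner_smul_left, Fin.prod_univ_succ]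

theorem coeff_contraction {ι : Type*} (e : HilbertBasis ι ℝ H) (f : HilbertTensorPower (n + 1) H)
    (i : ι) (j : Fin n → ι) : coeff e (contraction (e i) f) j = coeff e f (Fin.cons i j) := by
  rw [coeff, inner_contraction, coeff]
  congr 2
  ext k
  refine Fin.cases ?_ (fun k => ?_) k <;> simp

/-! ### Symmetric tensors are generated by powers of unit vectors -/

variable (n H) in
/-- The powers `h^{⊗n}` of unit vectors, and the unit of `H^{⊗0}` for `n = 0`. -/
def unitPowers : Set (HilbertTensorPower n H) :=
  {f | ∃ h : H, (‖h‖ = 1 ∨ n = 0) ∧ f = elemTensor fun _ => h}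

theorem span_unitPowers_le_symTensors :
    (Submodule.span ℝ (unitPowers n H)).topologicalClosure ≤ symTensors n H := by
  refine Submodule.topologicalClosure_minimal _ (Submodule.span_le.2 ?_) (isClosed_symTensors n H)
  rintro _ ⟨h, -, rfl⟩ σ x
  rw [inner_elemTensor, inner_elemTensor]
  exact Equiv.prod_comp σ fun k => inner ℝ h (x k)

/-- Polarization: if the form of a symmetric tensor vanishes on the diagonal, then so does its
`n`-th derivative there, which is `n!` times the form. -/
theorem eq_zero_of_inner_unitPowers {f : HilbertTensorPower n H} (hf : f ∈ symTensors n H)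
    (h : ∀ g ∈ unitPowers n H, inner ℝ f g = 0) : f = 0 := by
  have h1 : (fun x : H => tensorForm f fun _ => x) = 0 := by
    ext x
    rcases Nat.eq_zero_or_pos n with rfl | hn
    · exact h _ ⟨x, Or.inr rfl, rfl⟩
    · rcases eq_or_ne x 0 with rfl | hx
      · exact (tensorForm f).map_coord_zero ⟨0, hn⟩ rfl
      · have h2 : tensorForm f (fun _ => ‖x‖⁻¹ • x) = 0 :=
          h _ ⟨_, Or.inl (norm_smul_inv_norm hx), rfl⟩
        have h3 := (tensorForm f).map_smul_univ (fun _ => ‖x‖⁻¹) (fun _ => x)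
        rw [h2] at h3
        simpa [hx, eq_comm] using h3
  refine eq_zero_of_inner_elemTensor fun x => ?_
  have h2 := (tensorForm f).iteratedFDeriv_comp_diagonal 0 x
  rw [h1] at h2
  have h3 : ∀ σ : Equiv.Perm (Fin n), tensorForm f (fun i => x (σ i)) = inner ℝ f (elemTensor x) :=
    fun σ => hf σ x
  simp only [h3, Finset.sum_const, nsmul_eq_mul] at h2
  rw [show (0 : H → ℝ) = fun _ => 0 from rfl, iteratedFDeriv_fun_zero] at h2
  simpa [Fintype.card_perm, Nat.factorial_ne_zero, eq_comm] using h2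

theorem symTensors_le_span_unitPowers :
    symTensors n H ≤ (Submodule.span ℝ (unitPowers n H)).topologicalClosure := by
  intro f hf
  set K := (Submodule.span ℝ (unitPowers n H)).topologicalClosure with hK
  have : CompleteSpace K :=
    (Submodule.span ℝ (unitPowers n H)).isClosed_topologicalClosure.completeSpace_coe
  have h1 : f - K.starProjection f = 0 := by
    refine eq_zero_of_inner_unitPowers (sub_mem hf (span_unitPowers_le_symTensors
      (K.starProjection_apply_mem f))) fun g hg => ?_
    exact (K.mem_orthogonal' _).1 (K.sub_starProjection_mem_orthogonal f) g
      (Submodule.le_topologicalClosure _ (Submodule.subset_span hg))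
  rw [sub_eq_zero.1 h1]
  exact K.starProjection_apply_mem f

theorem symmetrize_eq_self {f : HilbertTensorPower n H} (hf : f ∈ symTensors n H) :
    symmetrize n H f = f :=
  Submodule.starProjection_eq_self_iff.2 hf

theorem symmetrize_mem (f : HilbertTensorPower n H) : symmetrize n H f ∈ symTensors n H :=
  Submodule.starProjection_apply_mem _ f

end Tensors

/-! ### The multiple integral as a continuous linear map -/

/-- A continuous linear map sending the powers of unit vectors to a closed subspace sends all
symmetric tensors there. -/
theorem map_mem_of_mem_symTensors {n : ℕ} {H E : Type*} [NormedAddCommGroup H]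
    [InnerProductSpace ℝ H] [NormedAddCommGroup E] [NormedSpace ℝ E]
    (A : HilbertTensorPower n H →L[ℝ] E) {K : Submodule ℝ E} (hK : IsClosed (K : Set E))
    (h : ∀ g ∈ unitPowers n H, A g ∈ K) {f : HilbertTensorPower n H}
    (hf : f ∈ symTensors n H) : A f ∈ K := by
  have h1 : (Submodule.span ℝ (unitPowers n H)).topologicalClosure ≤ K.comap A.toLinearMap :=
    Submodule.topologicalClosure_minimal _ (Submodule.span_le.2 h) (hK.preimage A.continuous)
  exact h1 (symTensors_le_span_unitPowers hf)

theorem elemTensor_const_mem_symTensors {n : ℕ} {H : Type*} [NormedAddCommGroup H]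
    [InnerProductSpace ℝ H] {h : H} (hh : ‖h‖ = 1) :
    elemTensor (fun _ : Fin n => h) ∈ symTensors n H :=
  span_unitPowers_le_symTensors (Submodule.le_topologicalClosure _
    (Submodule.subset_span ⟨h, Or.inl hh, rfl⟩))

section Wiener

variable {H : Type*} [NormedAddCommGroup H] [InnerProductSpace ℝ H]
  {Ω : Type*} [MeasurableSpace Ω] {P : Measure Ω} {W : H → Ω → ℝ}

/-- The variable `Hₙ(W(h))`, as an element of `L²(Ω)`. -/
noncomputable def hermiteLp (hW : IsIsonormal W P) (n : ℕ) (h : H) : Lp ℝ 2 P :=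
  (hW.memLp_aeval h (Polynomial.hermite n) ENNReal.ofNat_ne_top).toLp

theorem coeFn_hermiteLp (hW : IsIsonormal W P) (n : ℕ) (h : H) :
    hermiteLp hW n h =ᵐ[P] fun ω => Polynomial.aeval (W h ω) (Polynomial.hermite n) :=
  MemLp.coeFn_toLp _

theorem inner_hermiteLp (hW : IsIsonormal W P) {n : ℕ} {g : H} (hg : ‖g‖ = 1 ∨ n = 0) (h : H) :
    inner ℝ (hermiteLp hW n g) (hermiteLp hW n h) = n.factorial * inner ℝ g h ^ n := by
  have := (hW.isGaussianProcess.hasGaussianLaw_eval g).isProbabilityMeasure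
  have h1 : inner ℝ (hermiteLp hW n g) (hermiteLp hW n h) =
      ∫ ω, Polynomial.aeval (W g ω) (Polynomial.hermite n) *
        Polynomial.aeval (W h ω) (Polynomial.hermite n) ∂P := by
    rw [L2.inner_def]
    refine integral_congr_ae ?_
    filter_upwards [coeFn_hermiteLp hW n g, coeFn_hermiteLp hW n h] with ω h1 h2
    rw [h1, h2, real_inner_comm, RCLike.inner_apply, conj_trivial]
  rw [h1]
  rcases hg with hg | rfl
  · exact hW.integral_hermite_mul_hermite hg n
  · simp

theorem exists_chaosMap (hW : IsIsonormal W P) (n : ℕ) :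
    ∃ J : HilbertTensorPower n H →L[ℝ] Lp ℝ 2 P,
      ∀ h : H, (‖h‖ = 1 ∨ n = 0) → J (elemTensor fun _ => h) = hermiteLp hW n h := by
  obtain ⟨J, hJ⟩ := exists_clm_of_inner_eq
    (fun h : {h : H // ‖h‖ = 1 ∨ n = 0} => elemTensor (fun _ : Fin n => (h : H)))
    (fun h => hermiteLp hW n h) n.factorial fun g h => by
      rw [inner_hermiteLp hW g.2, inner_elemTensor]
      simp
  exact ⟨J, fun h hh => hJ ⟨h, hh⟩⟩

/-- A continuous linear map with `h^{⊗n} ↦ Hₙ(W(h))` for unit vectors `h`. It is determined by this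
on symmetric tensors only. -/
noncomputable def chaosMap (hW : IsIsonormal W P) (n : ℕ) :
    HilbertTensorPower n H →L[ℝ] Lp ℝ 2 P :=
  (exists_chaosMap hW n).choose

theorem chaosMap_elemTensor (hW : IsIsonormal W P) {n : ℕ} {h : H} (hh : ‖h‖ = 1 ∨ n = 0) :
    chaosMap hW n (elemTensor fun _ => h) = hermiteLp hW n h :=
  (exists_chaosMap hW n).choose_spec h hh

/-- The graph of the multiple integral on powers of unit vectors. -/
def hermiteGraph (W : H → Ω → ℝ) (P : Measure Ω) (n : ℕ) :
    Set (HilbertTensorPower n H × Lp ℝ 2 P) :=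
  {p | ∃ h : H, (‖h‖ = 1 ∨ n = 0) ∧ p.1 = elemTensor (fun _ => h) ∧
    p.2 =ᵐ[P] fun ω => Polynomial.aeval (W h ω) (Polynomial.hermite n)}

theorem snd_eq_of_mem_closure_hermiteGraph (hW : IsIsonormal W P) {n : ℕ}
    {p : HilbertTensorPower n H × Lp ℝ 2 P}
    (hp : p ∈ (Submodule.span ℝ (hermiteGraph W P n)).topologicalClosure) :
    p.2 = chaosMap hW n p.1 := by
  have h1 : (Submodule.span ℝ (hermiteGraph W P n)).topologicalClosure ≤
      (chaosMap hW n).toLinearMap.graph := by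
    refine Submodule.topologicalClosure_minimal _ (Submodule.span_le.2 ?_)
      (isClosed_eq continuous_snd ((chaosMap hW n).continuous.comp continuous_fst))
    rintro ⟨f, F⟩ ⟨h, hh, hf, hF⟩
    dsimp only at hf hF
    change F = chaosMap hW n f
    rw [hf, chaosMap_elemTensor hW hh]
    exact Lp.ext (hF.trans (coeFn_hermiteLp hW n h).symm)
  exact h1 hp

theorem mem_closure_hermiteGraph (hW : IsIsonormal W P) {n : ℕ} {f : HilbertTensorPower n H}
    (hf : f ∈ symTensors n H) :
    (f, chaosMap hW n f) ∈ (Submodule.span ℝ (hermiteGraph W P n)).topologicalClosure := by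
  refine map_mem_of_mem_symTensors
    ((ContinuousLinearMap.id ℝ (HilbertTensorPower n H)).prod (chaosMap hW n))
    (Submodule.isClosed_topologicalClosure _) ?_ hf
  rintro _ ⟨h, hh, rfl⟩
  refine Submodule.le_topologicalClosure _ (Submodule.subset_span ⟨h, hh, rfl, ?_⟩)
  exact (congrArg (fun F : Lp ℝ 2 P => (F : Ω → ℝ)) (chaosMap_elemTensor hW hh)).eventuallyEq.trans
    (coeFn_hermiteLp hW n h)

theorem multipleIntegral_eq (hW : IsIsonormal W P) (n : ℕ) (f : HilbertTensorPower n H) :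
    multipleIntegral W P n f = (chaosMap hW n ∘L symmetrize n H) f := by
  have hmem := mem_closure_hermiteGraph hW (symmetrize_mem f)
  have hdom : symmetrize n H f ∈ (wienerItoMap W P n).domain := ⟨_, hmem, rfl⟩
  rw [multipleIntegral, dif_pos hdom]
  refine snd_eq_of_mem_closure_hermiteGraph hW (Submodule.mem_graph_toLinearPMap ?_
    (⟨_, hdom⟩ : Submodule.map (LinearMap.fst ℝ (HilbertTensorPower n H) (Lp ℝ 2 P))
      (Submodule.span ℝ (hermiteGraph W P n)).topologicalClosure))
  intro p hp hp1
  rw [snd_eq_of_mem_closure_hermiteGraph hW hp, hp1, map_zero]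

theorem multipleIntegral_of_mem (hW : IsIsonormal W P) {n : ℕ} {f : HilbertTensorPower n H}
    (hf : f ∈ symTensors n H) : multipleIntegral W P n f = chaosMap hW n f := by
  rw [multipleIntegral_eq hW, ContinuousLinearMap.comp_apply, symmetrize_eq_self hf]

theorem hasSum_chaosTerm (hW : IsIsonormal W P) {ι : Type*} (e : HilbertBasis ι ℝ H) {n : ℕ}
    (f : HilbertTensorPower (n + 1) H) (i : ι) :
    HasSum (chaosTerm W P e f i) (multipleIntegral W P n (contraction (e i) f)) := by
  have h1 := (hasSum_coeff_smul_elemTensor e (contraction (e i) f)).mapL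
    (chaosMap hW n ∘L symmetrize n H)
  simp only [ContinuousLinearMap.map_smul, coeff_contraction] at h1
  rw [multipleIntegral_eq hW]
  refine (congrArg (fun t => HasSum t _) (funext fun j => ?_)).mpr h1
  rw [chaosTerm, multipleIntegral_eq hW]

/-! ### The Malliavin derivative of a multiple integral -/

/-- The map `X ↦ X h` from `L²(Ω)` to `L²(Ω; H)`. -/
noncomputable def smulLp (P : Measure Ω) (h : H) : Lp ℝ 2 P →L[ℝ] Lp H 2 P :=
  (ContinuousLinearMap.toSpanSingleton ℝ h).compLpL 2 P

theorem coeFn_smulLp (h : H) (F : Lp ℝ 2 P) : smulLp P h F =ᵐ[P] fun ω => F ω • h :=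
  (ContinuousLinearMap.toSpanSingleton ℝ h).coeFn_compLp F

theorem inner_smulLp (g h : H) (F G : Lp ℝ 2 P) :
    inner ℝ (smulLp P g F) (smulLp P h G) = inner ℝ g h * inner ℝ F G := by
  rw [L2.inner_def, L2.inner_def, ← integral_const_mul]
  refine integral_congr_ae ?_
  filter_upwards [coeFn_smulLp g F, coeFn_smulLp h G] with ω h1 h2
  rw [h1, h2, inner_smul_left, inner_smul_right, RCLike.inner_apply]
  simp only [conj_trivial]
  ring

theorem innerLp_smulLp (g h : H) (F : Lp ℝ 2 P) :
    innerLp P g (smulLp P h F) = (inner ℝ g h : ℝ) • F := by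
  refine Lp.ext ?_
  filter_upwards [coeFn_innerLp g (smulLp P h F), coeFn_smulLp h F,
    Lp.coeFn_smul (inner ℝ g h : ℝ) F] with ω h1 h2 h3
  rw [h1, h2, h3, inner_smul_right, Pi.smul_apply, smul_eq_mul, mul_comm]

variable [CompleteSpace H]

theorem exists_derivMap (hW : IsIsonormal W P) (n : ℕ) :
    ∃ T : HilbertTensorPower (n + 1) H →L[ℝ] Lp H 2 P, ∀ h : H, ‖h‖ = 1 →
      T (elemTensor fun _ => h) = ((n : ℝ) + 1) • smulLp P h (hermiteLp hW n h) := by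
  obtain ⟨T, hT⟩ := exists_clm_of_inner_eq
    (fun h : {h : H // ‖h‖ = 1} => elemTensor (fun _ : Fin (n + 1) => (h : H)))
    (fun h => ((n : ℝ) + 1) • smulLp P (h : H) (hermiteLp hW n h))
    (((n : ℝ) + 1) ^ 2 * n.factorial) fun g h => by
      rw [inner_smul_left, inner_smul_right, inner_smulLp, inner_hermiteLp hW (Or.inl g.2),
        inner_elemTensor]
      simp only [Finset.prod_const, Finset.card_univ, Fintype.card_fin, conj_trivial]
      ring
  exact ⟨T, fun h hh => hT ⟨h, hh⟩⟩

/-- A continuous linear map with `h^{⊗(n+1)} ↦ (n+1) Hₙ(W(h)) h` for unit vectors `h`. -/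
noncomputable def derivMap (hW : IsIsonormal W P) (n : ℕ) :
    HilbertTensorPower (n + 1) H →L[ℝ] Lp H 2 P :=
  (exists_derivMap hW n).choose

theorem derivMap_elemTensor (hW : IsIsonormal W P) (n : ℕ) {h : H} (hh : ‖h‖ = 1) :
    derivMap hW n (elemTensor fun _ => h) = ((n : ℝ) + 1) • smulLp P h (hermiteLp hW n h) :=
  (exists_derivMap hW n).choose_spec h hh

theorem mem_closure_smoothGraph (hW : IsIsonormal W P) {n : ℕ}
    {f : HilbertTensorPower (n + 1) H} (hf : f ∈ symTensors (n + 1) H) :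
    (chaosMap hW (n + 1) f, derivMap hW n f) ∈
      (Submodule.span ℝ (smoothGraph W P)).topologicalClosure := by
  refine map_mem_of_mem_symTensors ((chaosMap hW (n + 1)).prod (derivMap hW n))
    (Submodule.isClosed_topologicalClosure _) ?_ hf
  rintro _ ⟨h, hh, rfl⟩
  have hh1 : ‖h‖ = 1 := hh.resolve_right n.succ_ne_zero
  refine Submodule.le_topologicalClosure _ (Submodule.subset_span ⟨1, fun _ => h, _,
    hasTemperateGrowth_aeval_apply 0 (Polynomial.hermite (n + 1)), ?_, ?_⟩)
  · change (chaosMap hW (n + 1) (elemTensor fun _ => h) : Lp ℝ 2 P) =ᵐ[P] _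
    rw [chaosMap_elemTensor hW hh]
    exact coeFn_hermiteLp hW _ h
  · change (derivMap hW n (elemTensor fun _ => h) : Lp H 2 P) =ᵐ[P] _
    rw [derivMap_elemTensor hW n hh1]
    filter_upwards [Lp.coeFn_smul ((n : ℝ) + 1) (smulLp P h (hermiteLp hW n h)),
      coeFn_smulLp h (hermiteLp hW n h), coeFn_hermiteLp hW n h] with ω h1 h2 h3
    rw [h1, Pi.smul_apply, h2, h3, (hasFDerivAt_aeval_apply _ _ _).fderiv,
      derivative_hermite_succ]
    simp [smul_smul]

/-- The component of the derivative of `Iₙ₊₁(f)` along `h` is `n + 1` times the multiple integral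
of the contraction of `f` with `h`. -/
theorem innerLp_derivMap (hW : IsIsonormal W P) {n : ℕ}
    {f : HilbertTensorPower (n + 1) H} (hf : f ∈ symTensors (n + 1) H) (h : H) :
    innerLp P h (derivMap hW n f) =
      ((n : ℝ) + 1) • multipleIntegral W P n (contraction h f) := by
  have h1 := map_mem_of_mem_symTensors (innerLp P h ∘L derivMap hW n -
      ((n : ℝ) + 1) • (chaosMap hW n ∘L symmetrize n H) ∘L contraction h) (K := ⊥)
    isClosed_singleton ?_ hf
  · rw [multipleIntegral_eq hW]
    exact sub_eq_zero.1 h1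
  · rintro _ ⟨g, hg, rfl⟩
    have hg1 : ‖g‖ = 1 := hg.resolve_right n.succ_ne_zero
    refine sub_eq_zero.2 ?_
    change innerLp P h (derivMap hW n (elemTensor fun _ => g)) =
      ((n : ℝ) + 1) • chaosMap hW n (symmetrize n H (contraction h (elemTensor fun _ => g)))
    rw [derivMap_elemTensor hW n hg1, map_smul, innerLp_smulLp, contraction_elemTensor, map_smul,
      map_smul, symmetrize_eq_self (elemTensor_const_mem_symTensors hg1),
      chaosMap_elemTensor hW (Or.inl hg1), real_inner_comm]

theorem multipleIntegral_mem_domain (hW : IsIsonormal W P) {n : ℕ}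
    {f : HilbertTensorPower (n + 1) H} (hf : f ∈ symTensors (n + 1) H) :
    multipleIntegral W P (n + 1) f ∈ (malliavinD W P).domain := by
  rw [multipleIntegral_of_mem hW hf]
  exact ⟨_, mem_closure_smoothGraph hW hf, rfl⟩

variable [SeparableSpace H]

theorem malliavinD_multipleIntegral (hW : IsIsonormal W P) {n : ℕ}
    {f : HilbertTensorPower (n + 1) H} (hf : f ∈ symTensors (n + 1) H)
    (hF : multipleIntegral W P (n + 1) f ∈ (malliavinD W P).domain) :
    malliavinD W P ⟨_, hF⟩ = derivMap hW n f := by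
  have h1 := Submodule.mem_graph_toLinearPMap
    (fun _ hp hp1 => hW.eq_zero_of_mem_closure_smoothGraph hp hp1)
    (⟨_, hF⟩ : Submodule.map (LinearMap.fst ℝ (Lp ℝ 2 P) (Lp H 2 P))
      (Submodule.span ℝ (smoothGraph W P)).topologicalClosure)
  have h2 := mem_closure_smoothGraph hW hf
  rw [← multipleIntegral_of_mem hW hf] at h2
  have h3 := hW.eq_zero_of_mem_closure_smoothGraph (sub_mem h1 h2) (sub_self _)
  exact sub_eq_zero.1 h3

/-- The series `S_{i,f}` are the coordinates of the Malliavin derivative of `Iₙ₊₁(f)`. -/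
theorem ae_S_eq_inner_malliavinD (hW : IsIsonormal W P) {ι : Type*} [Countable ι]
    (e : HilbertBasis ι ℝ H) {n : ℕ} {f : HilbertTensorPower (n + 1) H}
    (hf : f ∈ symTensors (n + 1) H)
    (hF : multipleIntegral W P (n + 1) f ∈ (malliavinD W P).domain) :
    ∀ᵐ ω ∂P, ∀ i, S W P e f i ω = inner ℝ (malliavinD W P ⟨_, hF⟩ ω) (e i) := by
  rw [malliavinD_multipleIntegral hW hf hF, ae_all_iff]
  intro i
  have h1 : S W P e f i = innerLp P (e i) (derivMap hW n f) := by
    rw [innerLp_derivMap hW hf, S, (hasSum_chaosTerm hW e f i).tsum_eq]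
  rw [h1]
  filter_upwards [coeFn_innerLp (e i) (derivMap hW n f)] with ω h2
  rw [h2, real_inner_comm]

end Wiener

/-! ### Lagrange's identity in a Hilbert space -/

/-- Lagrange's identity: `‖x‖² ‖y‖² - ⟪x, y⟫²` is half the sum of the squares of all `2 × 2` minors
of the coordinates of `x` and `y`. -/
theorem hasSum_sq_minors {H ι : Type*} [NormedAddCommGroup H] [InnerProductSpace ℝ H]
    (e : HilbertBasis ι ℝ H) (x y : H) :
    HasSum (fun p : ι × ι => (inner ℝ x (e p.1) * inner ℝ y (e p.2) -
        inner ℝ x (e p.2) * inner ℝ y (e p.1)) ^ 2)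
      (2 * (‖x‖ ^ 2 * ‖y‖ ^ 2 - inner ℝ x y ^ 2)) := by
  have h : ∀ u v : H, HasSum (fun i => inner ℝ u (e i) * inner ℝ v (e i)) (inner ℝ u v) := by
    intro u v
    simpa only [real_inner_comm] using e.hasSum_inner_mul_inner u v
  have hmul : ∀ {a b : ι → ℝ} {s t : ℝ}, HasSum a s → HasSum b t →
      HasSum (fun p : ι × ι => a p.1 * b p.2) (s * t) := fun ha hb =>
    ha.mul hb (summable_mul_of_summable_norm ha.summable.norm hb.summable.norm)
  have h3 := ((hmul (h x x) (h y y)).add (hmul (h y y) (h x x))).sub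
    ((hmul (h x y) (h x y)).mul_left 2)
  have h4 : inner ℝ x x * inner ℝ y y + inner ℝ y y * inner ℝ x x -
      2 * (inner ℝ x y * inner ℝ x y) = 2 * (‖x‖ ^ 2 * ‖y‖ ^ 2 - inner ℝ x y ^ 2) := by
    rw [real_inner_self_eq_norm_sq, real_inner_self_eq_norm_sq]
    ring
  rw [← h4]
  convert! h3 using 1
  ext p
  ring

end MalliavinDet

theorem proposition1 {H : Type*} [NormedAddCommGroup H] [InnerProductSpace ℝ H] [CompleteSpace H]
    [SeparableSpace H] {Ω : Type*} [MeasurableSpace Ω] (P : Measure Ω) [IsProbabilityMeasure P]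
    (W : H → Ω → ℝ) (hW : IsIsonormal W P)
    {ι : Type*} [Countable ι] (e : HilbertBasis ι ℝ H) (n m : ℕ)
    (f : HilbertTensorPower (n + 1) H) (hf : f ∈ symTensors (n + 1) H)
    (g : HilbertTensorPower (m + 1) H) (hg : g ∈ symTensors (m + 1) H) :
    (∀ i, Summable (chaosTerm W P e f i)) ∧
    (∀ i, Summable (chaosTerm W P e g i)) ∧
    ∃ (hF : multipleIntegral W P (n + 1) f ∈ (malliavinD W P).domain)
      (hG : multipleIntegral W P (m + 1) g ∈ (malliavinD W P).domain),
      (∀ᵐ ω ∂P, ∀ i, S W P e f i ω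
        = inner ℝ (malliavinD W P ⟨_, hF⟩ ω) (e i)) ∧
      (∀ᵐ ω ∂P, ∀ i, S W P e g i ω
        = inner ℝ (malliavinD W P ⟨_, hG⟩ ω) (e i)) ∧
      (∀ᵐ ω ∂P,
        Summable (fun p : ι × ι =>
          (S W P e f p.1 ω * S W P e g p.2 ω
            - S W P e f p.2 ω * S W P e g p.1 ω) ^ 2) ∧
        (malliavinMatrix (malliavinD W P ⟨_, hF⟩)
            (malliavinD W P ⟨_, hG⟩) ω).det
          = 1 / 2 * ∑' p : ι × ι,
            (S W P e f p.1 ω * S W P e g p.2 ω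
              - S W P e f p.2 ω * S W P e g p.1 ω) ^ 2) := by
  have hF := multipleIntegral_mem_domain hW hf
  have hG := multipleIntegral_mem_domain hW hg
  have hSf := ae_S_eq_inner_malliavinD hW e hf hF
  have hSg := ae_S_eq_inner_malliavinD hW e hg hG
  refine ⟨fun i => (hasSum_chaosTerm hW e f i).summable,
    fun i => (hasSum_chaosTerm hW e g i).summable, hF, hG, hSf, hSg, ?_⟩
  filter_upwards [hSf, hSg] with ω h1 h2
  simp only [h1, h2]
  have h3 := hasSum_sq_minors e (malliavinD W P ⟨_, hF⟩ ω) (malliavinD W P ⟨_, hG⟩ ω)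
  refine ⟨h3.summable, ?_⟩
  rw [h3.tsum_eq, malliavinMatrix, Matrix.det_fin_two_of]
  ring
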